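/- Let $m\ge 4$ and $n\ge 6$ be even integers, write $n=2n'$, let $\ell\in\mathbb{Z}_n$ be even and $k\in\mathbb{Z}_n$ be odd, and (all equalities below being in $\mathbb{Z}_n$) suppose that $2k\neq\pm2$, that $2k^2=\pm2$, and that one of the following holds: \begin{itemize} \item $\ell k=\pm\ell$, and at least one of $k^2=\pm1$ and $4\mid m$ holds; \item $\ell k=n'\pm\ell$, $m\equiv 2\pmod 4$ and $k^2=n'\pm1$. \end{itemize} (Different signs $\pm$ may be chosen independently; $x\neq\pm y$ means that $x\neq y$ and $x\neq -y$.) Let $\Gamma=\mathcal{X}_a(m,n,k,\ell)$ be the cubic graph of order $mn$ with vertices $u_{i,j}$, $i\in\mathbb{Z}_m$, $j\in\mathbb{Z}_n$, and the following adjacencies, where $i$ is represented in $\{0,\dots,m-1\}$ and $k_i=1$ for $i$ even, $k_i=k$ for $i$ odd: \begin{itemize} \item $u_{i,j}\sim u_{i+1,j}$ for $0\le i\le m-2$ and $j\equiv i\pmod 2$; \item $u_{m-1,j}\sim u_{0,j+\ell}$ for $j\equiv m-1\pmod 2$; \item $u_{i,j}\sim u_{i,j\pm k_i}$ for all $i$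 and $j$. \end{itemize} Let $\mathcal{C}=\{C_i : i\in\mathbb{Z}_m\}$ be the $2$-factor of $\Gamma$ consisting of the $n$-cycles $C_i$ induced on the sets $V_i=\{u_{i,j} : j\in\mathbb{Z}_n\}$. Suppose that $n\ge 14$. If $\mathcal{C}$ is not preserved by $\mathrm{Aut}(\Gamma)$, then either $4k=\pm4$ in $\mathbb{Z}_n$, or $\Gamma=\mathcal{X}_a(4,20,k,10)$ for some $k\in\{\pm3,\pm7\}$ (that is, $m=4$, $n=20$, $\ell=10$ and $k\in\{\pm3,\pm7\}\subset\mathbb{Z}_{20}$). -/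

import Mathlib

/-- The graph `𝒳ₐ(m, n, S, ℓ)`, `S = [{a 0, b 0}, …, {a (m-1), b (m-1)}]`, on the vertices
`u_{i,j} = (i, j)` with `i ∈ ℤ_m`, `j ∈ ℤ_n` (for `n` even, the parity of `j ∈ ℤ_n` is that of its
representative in `{0, …, n-1}`; the index `i` is likewise represented in `{0, …, m-1}`).
`fromRel` takes the symmetric closure of the listed adjacencies. -/
def altGraph (m n : ℕ) (a b : ZMod m → ZMod n) (l : ZMod n) : SimpleGraph (ZMod m × ZMod n) :=
  SimpleGraph.fromRel fun u v =>
    -- u_{i,j} ~ u_{i+1,j} for 0 ≤ i ≤ m-2 and j ≡ i (mod 2)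
    (u.1.val + 1 < m ∧ u.2.val ≡ u.1.val [MOD 2] ∧ v = (u.1 + 1, u.2)) ∨
    -- u_{m-1,j} ~ u_{0,j+ℓ} for j ≡ m-1 (mod 2)
    (u.1.val + 1 = m ∧ u.2.val ≡ u.1.val [MOD 2] ∧ v = (0, u.2 + l)) ∨
    -- u_{i,j} ~ u_{i,j+a_i}, u_{i,j+b_i} for j ≡ i (mod 2)
    (u.2.val ≡ u.1.val [MOD 2] ∧ (v = (u.1, u.2 + a u.1) ∨ v = (u.1, u.2 + b u.1)))

/-- The entry `k_i` of the signature `[1, k, 1, k, …, 1, k]`. -/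
def altSign (m n : ℕ) (k : ZMod n) (i : ZMod m) : ZMod n :=
  if Even i.val then 1 else k

/-- The graph `𝒳ₐ(m, n, k, ℓ)`, i.e. `𝒳ₐ(m, n, S, ℓ)` with
`S = [{1, -1}, {k, -k}, …, {1, -1}, {k, -k}]`. -/
def altX (m n : ℕ) (k l : ZMod n) : SimpleGraph (ZMod m × ZMod n) :=
  altGraph m n (altSign m n k) (fun i => -altSign m n k i) l

/-- The cycle `C_i`: the subgraph of `𝒳ₐ(m, n, k, ℓ)` induced on `V_i = {u_{i,j} : j ∈ ℤ_n}`. -/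
def altCycle (m n : ℕ) (k l : ZMod n) (i : ZMod m) : (altX m n k l).Subgraph :=
  (⊤ : (altX m n k l).Subgraph).induce {u | u.1 = i}

/-- The `2`-factor `𝒞 = {C_i : i ∈ ℤ_m}`. -/
def altTwoFactor (m n : ℕ) (k l : ZMod n) : Set (altX m n k l).Subgraph :=
  Set.range (altCycle m n k l)

/-- A set `𝒞` of subgraphs of `Γ` is preserved by `Aut(Γ)`. -/
def PreservedByAut {V : Type*} (Γ : SimpleGraph V) (𝒞 : Set Γ.Subgraph) : Prop :=
  ∀ φ : Γ ≃g Γ, (fun C : Γ.Subgraph => C.map φ.toHom) '' 𝒞 = 𝒞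

/-- The conditions on `m`, `n`, `k`, `ℓ` under which `𝒳ₐ(m, n, k, ℓ)` admits a vertex-transitive
group of automorphisms preserving `𝒞`. -/
structure AltParams (m n : ℕ) (k l : ZMod n) : Prop where
  four_le_m : 4 ≤ m
  even_m : Even m
  six_le_n : 6 ≤ n
  even_n : Even n
  even_l : Even l
  odd_k : Odd k
  two_mul_ne : 2 * k ≠ 2 ∧ 2 * k ≠ -2
  two_mul_sq : 2 * k ^ 2 = 2 ∨ 2 * k ^ 2 = -2
  cond :
    ((l * k = l ∨ l * k = -l) ∧ ((k ^ 2 = 1 ∨ k ^ 2 = -1) ∨ 4 ∣ m)) ∨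
    ((l * k = ((n / 2 : ℕ) : ZMod n) + l ∨ l * k = ((n / 2 : ℕ) : ZMod n) - l) ∧
      m ≡ 2 [MOD 4] ∧
      (k ^ 2 = ((n / 2 : ℕ) : ZMod n) + 1 ∨ k ^ 2 = ((n / 2 : ℕ) : ZMod n) - 1))

/-! An automorphism preserves, for each directed edge, the number of closed cyclically reduced walks
of length 10 that start with it. If this number distinguishes edges between levels from edges of the
cycles `C_i`, then automorphisms permute the levels, and `𝒞` is preserved
(`preservedByAut_of_separates`).

The graph is covered by states in `ℤ³`, so walks become words in three moves. Whether a word closes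
depends only on its displacement, which is bounded since the length is 10. Short relations in `ℤ_n`
are excluded by a norm argument using `2k² = ±2` (`EvenRelation.eq_zero`), unless `4k = ±4` or `n =
20`. So words of displacement zero are closed, and otherwise only those winding once around the
levels can be, which needs `m = 4`. Multiplication by `k` leaves few patterns of winding relations
(`WindingRelation.cases`), and each is settled by a finite count. For `n = 20` the counts are made
with the explicit values of `k`; only `m = 4`, `ℓ = 10` escapes. -/

/-! ### Reduced words of length 10 and their finite counts -/

/-- The three moves at a state `(i, a, b)`, which stands for the vertex at level `i`
and position `a + b * k`. Move `0` follows the edge between two levels, moves `1` and `2` go along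
the cycle of the level. -/
def stateMove : Fin 3 → ℤ × ℤ × ℤ → ℤ × ℤ × ℤ
  | 0, (i, a, b) => if (i + a + b) % 2 = 0 then (i + 1, a, b) else (i - 1, a, b)
  | 1, (i, a, b) => if i % 2 = 0 then (i, a + 1, b) else (i, a, b + 1)
  | 2, (i, a, b) => if i % 2 = 0 then (i, a - 1, b) else (i, a, b - 1)

/-- The move that undoes a given move. -/
def oppMove : Fin 3 → Fin 3
  | 0 => 0
  | 1 => 2
  | 2 => 1

/-- The two moves that may follow a given move in a reduced word. -/
def nextMoves : Fin 3 → Fin 3 × Fin 3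
  | 0 => (1, 2)
  | 1 => (0, 1)
  | 2 => (0, 2)

/-- The ends of the reduced continuations by `t` moves of a word that has last move `x` and has
arrived at `s`, provided that the last move of the continuation does not undo `x₀`. -/
def wordEnds (x₀ : Fin 3) : ℕ → Fin 3 → ℤ × ℤ × ℤ → List (ℤ × ℤ × ℤ)
  | 0, x, s => if oppMove x = x₀ then [] else [s]
  | t + 1, x, s =>
    wordEnds x₀ t (nextMoves x).1 (stateMove (nextMoves x).1 s) ++
      wordEnds x₀ t (nextMoves x).2 (stateMove (nextMoves x).2 s)

/-- The displacements of the cyclically reduced words of length `10` with first move `x`, read from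
the state `(p, q, 0)`. -/
def wordShifts (p q : Fin 2) (x : Fin 3) : List (ℤ × ℤ × ℤ) :=
  (wordEnds x 9 x (stateMove x (p.val, q.val, 0))).map fun s => (s.1 - p.val, s.2.1 - q.val, s.2.2)

/-- If the words whose displacement satisfies `P` are the closed ones, then their number separates
the edges between levels from those inside a level. -/
def Separates (P : ℤ × ℤ × ℤ → Bool) : Prop :=
  -- Taking `A` from a finite list makes the statement decidable.
  ∃ A ∈ [8, 12], ∀ p q : Fin 2, (wordShifts p q 0).countP P = A ∧
    (wordShifts p q 1).countP P ≠ A ∧ (wordShifts p q 2).countP P ≠ A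

instance (P : ℤ × ℤ × ℤ → Bool) : Decidable (Separates P) := by
  unfold Separates; infer_instance

/-- Bounds for the displacements of the words of length `10` that change the level by `0` or
`±4`. -/
def shiftBound (s : ℤ × ℤ × ℤ) : Prop :=
  (-5 ≤ s.1 ∧ s.1 ≤ 5) ∧
  (s.1 = 0 → 2 ∣ s.2.1 ∧ 2 ∣ s.2.2 ∧ ((s.2.1.natAbs + s.2.2.natAbs ≤ 8) ∨
    (s.2.1.natAbs ≤ 10 ∧ s.2.2 = 0) ∨ (s.2.1 = 0 ∧ s.2.2.natAbs ≤ 10))) ∧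
  (s.1.natAbs = 4 → 2 ∣ s.2.1 ∧ 2 ∣ s.2.2 ∧
    s.2.1.natAbs + s.2.2.natAbs ≤ 6 ∧ s.2.1.natAbs ≤ 4 ∧ s.2.2.natAbs ≤ 4)

instance (s : ℤ × ℤ × ℤ) : Decidable (shiftBound s) := by
  unfold shiftBound; infer_instance

/-- Two consecutive moves `0` cancel, also cyclically, so at most five of the ten moves change the
level. Net change 0 leaves at most eight moves along cycles, or all ten inside one level; net change
±4 leaves at most six. -/
theorem shiftBound_of_mem_wordShifts :
    ∀ p q : Fin 2, ∀ x : Fin 3, ∀ s ∈ wordShifts p q x, shiftBound s := by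
  decide +kernel

/-- The displacements that are closed if the only relations are that `(4, c, d)` is closed for
`(c, d) ∈ R`. -/
def closedShift (R : List (ℤ × ℤ)) (s : ℤ × ℤ × ℤ) : Bool :=
  (s.1 = 0 ∧ s.2 = (0, 0)) ∨ (s.1 = 4 ∧ s.2 ∈ R) ∨ (s.1 = -4 ∧ -s.2 ∈ R)

theorem separates_closedShift_nil : Separates (closedShift []) := by
  decide +kernel

theorem separates_closedShift_zero : Separates (closedShift [(0, 0)]) := by
  decide +kernel

theorem separates_closedShift_two : ∀ a ∈ [(2 : ℤ), -2], ∀ b ∈ [(2 : ℤ), -2],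
    Separates (closedShift [(a, b)]) := by
  decide +kernel

/-- The two entries are a winding relation and its image under multiplication by `±k`; see
`WindingRelation.swap`. -/
theorem separates_closedShift_four : ∀ a ∈ [(1 : ℤ), -1], ∀ b ∈ [(1 : ℤ), -1],
    Separates (closedShift [(4 * a, 2 * b), (-2 * a, -4 * b)]) := by
  decide +kernel

/-- Here short nontrivial relations exist, such as `6 - 2k = 0` for `k = 3`, so the congruence
itself is tested. -/
theorem separates_twenty : ∀ c ∈ [(3 : ℤ), -3, 7, -7],
    Separates (fun s => s.1 = 0 ∧ (s.2.1 + s.2.2 * c) % 20 = 0) := by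
  decide +kernel

theorem separates_twenty_four : ∀ c ∈ [(3 : ℤ), -3, 7, -7],
    Separates (fun s => (s.1 = 0 ∨ s.1 = 4 ∨ s.1 = -4) ∧ (s.2.1 + s.2.2 * c) % 20 = 0) := by
  decide +kernel

/-! ### Non-backtracking closed walks and words -/

open Classical in
/-- The number of non-backtracking continuations by `t` steps of a walk that has arrived at `v`
from `u`, provided that the continuation ends at `z` and does not arrive there from `b`. -/
noncomputable def walkCount {V : Type*} [Fintype V] (G : SimpleGraph V) (z b : V) : ℕ → V → V → ℕ
  | 0, u, v => if v = z ∧ u ≠ b then 1 else 0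
  | t + 1, u, v => ∑ w ∈ Finset.univ.filter (fun w => G.Adj v w ∧ w ≠ u), walkCount G z b t v w

theorem walkCount_iso {V : Type*} [Fintype V] {G : SimpleGraph V} (φ : G ≃g G) (z b : V) (t : ℕ)
    (u v : V) : walkCount G (φ z) (φ b) t (φ u) (φ v) = walkCount G z b t u v := by
  classical
  induction t generalizing u v with
  | zero => simp [walkCount]
  | succ t ih =>
    simp only [walkCount]
    symm
    refine Finset.sum_bij' (fun w _ => φ w) (fun w _ => φ.symm w) ?_ ?_ ?_ ?_ ?_
    · intro w hw
      simpa [φ.map_adj_iff] using hw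
    · intro w hw
      simp only [Finset.mem_filter, Finset.mem_univ, true_and] at hw ⊢
      refine ⟨?_, fun h => hw.2 (by rw [← h]; simp)⟩
      rw [← φ.map_adj_iff]
      simpa using hw.1
    · simp
    · simp
    · intro w _
      exact (ih v w).symm

/-- A labelling by `Fin 3` of the edges at each vertex, compatible with `oppMove`. -/
structure CubicMoves {V : Type*} (G : SimpleGraph V) (μ : Fin 3 → V → V) : Prop where
  adj_iff : ∀ v w, G.Adj v w ↔ ∃ x, w = μ x v
  opp : ∀ x v, μ (oppMove x) (μ x v) = v
  inj : ∀ v, Function.Injective fun x => μ x v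

theorem CubicMoves.filter_adj {V : Type*} [Fintype V] [DecidableEq V] {G : SimpleGraph V}
    {μ : Fin 3 → V → V} (h : CubicMoves G μ) (x : Fin 3) (u : V)
    [DecidablePred fun w => G.Adj (μ x u) w ∧ w ≠ u] :
    Finset.univ.filter (fun w => G.Adj (μ x u) w ∧ w ≠ u) =
      {μ (nextMoves x).1 (μ x u), μ (nextMoves x).2 (μ x u)} := by
  have key : ∀ x y : Fin 3, y ≠ oppMove x ↔ y = (nextMoves x).1 ∨ y = (nextMoves x).2 := by
    decide
  ext w
  simp only [Finset.mem_filter, Finset.mem_univ, true_and, h.adj_iff, Finset.mem_insert,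
    Finset.mem_singleton]
  constructor
  · rintro ⟨⟨y, rfl⟩, hy⟩
    have : y ≠ oppMove x := fun e => hy (by rw [e, h.opp])
    rcases (key x y).1 this with e | e <;> simp [e]
  · have aux : ∀ y, y ≠ oppMove x → μ y (μ x u) ≠ u := fun y hy e =>
      hy (h.inj (μ x u) (e.trans (h.opp x u).symm))
    rintro (rfl | rfl)
    · exact ⟨⟨_, rfl⟩, aux _ ((key _ _).2 (Or.inl rfl))⟩
    · exact ⟨⟨_, rfl⟩, aux _ ((key _ _).2 (Or.inr rfl))⟩

/-- In a graph covered by the states, walks are counted by words. -/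
theorem walkCount_eq_countP {V : Type*} [Fintype V] [DecidableEq V] {G : SimpleGraph V}
    {μ : Fin 3 → V → V} (h : CubicMoves G μ) (π : ℤ × ℤ × ℤ → V)
    (hπ : ∀ x s, π (stateMove x s) = μ x (π s)) (z : V) (x₀ : Fin 3) (t : ℕ) (x : Fin 3)
    (u : V) (s : ℤ × ℤ × ℤ) (hs : π s = μ x u) :
    walkCount G z (μ x₀ z) t u (μ x u) =
      (wordEnds x₀ t x s).countP (fun s' => π s' = z) := by
  induction t generalizing x u s with
  | zero =>
    have e : u = μ (oppMove x) (π s) := by rw [hs, h.opp]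
    simp only [walkCount, wordEnds]
    by_cases hz : π s = z
    · by_cases hx : oppMove x = x₀
      · have : u = μ x₀ z := by rw [e, hz, hx]
        simp [hx, this]
      · have : u ≠ μ x₀ z := by
          rw [e, hz]
          exact fun e' => hx (h.inj z e')
        simp [hx, ← hs, hz, this]
    · have : μ x u ≠ z := by rwa [← hs]
      by_cases hx : oppMove x = x₀ <;> simp [hx, hz, this]
  | succ t ih =>
    have hne : ∀ x, (nextMoves x).1 ≠ (nextMoves x).2 := by decide
    simp only [walkCount, wordEnds, List.countP_append]
    rw [h.filter_adj, Finset.sum_pair (fun e => hne x (h.inj _ e)),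
      ih _ _ (stateMove (nextMoves x).1 s) (by rw [hπ, hs]),
      ih _ _ (stateMove (nextMoves x).2 s) (by rw [hπ, hs])]

/-! ### The covering of the graph by states -/

/-- The parity of an element of `ℤ_n`, for `n` even. -/
def zmodParity (n : ℕ) (hn : 2 ∣ n) : ZMod n →+* ZMod 2 := ZMod.castHom hn (ZMod 2)

theorem zmodParity_eq_val (n : ℕ) [NeZero n] (hn : 2 ∣ n) (x : ZMod n) :
    zmodParity n hn x = (x.val : ZMod 2) := by
  rw [zmodParity, ZMod.castHom_apply, ZMod.natCast_val]

theorem zmodParity_of_even {n : ℕ} (hn : 2 ∣ n) {x : ZMod n} (hx : Even x) :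
    zmodParity n hn x = 0 := by
  obtain ⟨y, rfl⟩ := hx
  rw [map_add]
  exact CharTwo.add_self_eq_zero _

theorem zmodParity_of_odd {n : ℕ} (hn : 2 ∣ n) {x : ZMod n} (hx : Odd x) :
    zmodParity n hn x = 1 := by
  obtain ⟨y, rfl⟩ := hx
  rw [map_add, map_one, two_mul, map_add, CharTwo.add_self_eq_zero, zero_add]

theorem val_modEq_iff {m n : ℕ} [NeZero m] [NeZero n] (hm : 2 ∣ m) (hn : 2 ∣ n) (x : ZMod n)
    (y : ZMod m) : x.val ≡ y.val [MOD 2] ↔ zmodParity n hn x = zmodParity m hm y := by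
  rw [zmodParity_eq_val, zmodParity_eq_val, ZMod.natCast_eq_natCast_iff]

theorem even_val_iff {m : ℕ} [NeZero m] (hm : 2 ∣ m) (y : ZMod m) :
    Even y.val ↔ zmodParity m hm y = 0 := by
  rw [zmodParity_eq_val, ZMod.natCast_eq_zero_iff_even]

/-- The moves in `𝒳ₐ(m, n, k, ℓ)`. -/
def altMove (m n : ℕ) (k l : ZMod n) : Fin 3 → ZMod m × ZMod n → ZMod m × ZMod n
  | 0, v =>
    if v.2.val ≡ v.1.val [MOD 2] then (v.1 + 1, if v.1.val + 1 = m then v.2 + l else v.2)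
    else (v.1 - 1, if v.1.val = 0 then v.2 - l else v.2)
  | 1, v => (v.1, v.2 + altSign m n k v.1)
  | 2, v => (v.1, v.2 - altSign m n k v.1)

/-- The vertex of `𝒳ₐ(m, n, k, ℓ)` represented by a state, relative to the level `2 h` and the
position `2 g`. -/
def altCover (m n : ℕ) (k l : ZMod n) (h g : ℤ) (s : ℤ × ℤ × ℤ) : ZMod m × ZMod n :=
  (((2 * h + s.1 : ℤ) : ZMod m),
    ((2 * g + s.2.1 : ℤ) : ZMod n) + (s.2.2 : ZMod n) * k + (((2 * h + s.1) / m : ℤ) : ZMod n) * l)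

section

variable {m n : ℕ} {k l : ZMod n}

theorem AltParams.neZero_m (h : AltParams m n k l) : NeZero m :=
  ⟨by have := h.four_le_m; omega⟩

theorem AltParams.neZero_n (h : AltParams m n k l) : NeZero n :=
  ⟨by have := h.six_le_n; omega⟩

theorem AltParams.fact_one_lt_m (h : AltParams m n k l) : Fact (1 < m) :=
  ⟨by have := h.four_le_m; omega⟩

theorem AltParams.two_ne_zero (h : AltParams m n k l) : (2 : ZMod n) ≠ 0 := by
  intro e
  have h6 := h.six_le_n
  have : ((2 : ℕ) : ZMod n) = 0 := by exact_mod_cast e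
  rw [ZMod.natCast_eq_zero_iff] at this
  have := Nat.le_of_dvd (by norm_num) this
  omega

/-- Ensures that moves `1` and `2` lead to different neighbours. -/
theorem AltParams.two_mul_altSign_ne_zero (h : AltParams m n k l) (i : ZMod m) :
    2 * altSign m n k i ≠ 0 := by
  unfold altSign
  split_ifs
  · simpa using h.two_ne_zero
  · intro e
    have e' : 2 * k ^ 2 = 0 := by linear_combination k * e
    rcases h.two_mul_sq with h2 | h2 <;> rw [e'] at h2
    · exact h.two_ne_zero h2.symm
    · exact h.two_ne_zero (neg_eq_zero.1 h2.symm)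

theorem zmodParity_altCover_fst (h : AltParams m n k l) (c g : ℤ) (s : ℤ × ℤ × ℤ) :
    zmodParity m h.even_m.two_dvd (altCover m n k l c g s).1 = (s.1 : ZMod 2) := by
  simp only [altCover, map_intCast]
  push_cast
  rw [show (2 : ZMod 2) = 0 from rfl]
  ring

/-- As `k` is odd and `l` even, the parity of the position does not depend on how often the levels
have been wound around. -/
theorem zmodParity_altCover_snd (h : AltParams m n k l) (c g : ℤ) (s : ℤ × ℤ × ℤ) :
    zmodParity n h.even_n.two_dvd (altCover m n k l c g s).2 = (s.2.1 + s.2.2 : ℤ) := by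
  simp only [altCover, map_add, map_mul, map_intCast, zmodParity_of_odd _ h.odd_k,
    zmodParity_of_even _ h.even_l]
  push_cast
  rw [show (2 : ZMod 2) = 0 from rfl]
  ring

theorem val_altCover_fst (h : AltParams m n k l) (c g : ℤ) (s : ℤ × ℤ × ℤ) :
    (((altCover m n k l c g s).1.val : ℕ) : ℤ) = (2 * c + s.1) % m := by
  have := h.neZero_m
  exact ZMod.val_intCast _

/-- The floor quotient by `m` in `altCover` counts crossings from level `m - 1` to level `0`, each
of which adds `l`. -/
theorem altCover_stateMove (h : AltParams m n k l) (c g : ℤ) (x : Fin 3) (s : ℤ × ℤ × ℤ) :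
    altCover m n k l c g (stateMove x s) = altMove m n k l x (altCover m n k l c g s) := by
  have := h.neZero_m
  have := h.neZero_n
  have hm4 := h.four_le_m
  have hsign : altSign m n k (altCover m n k l c g s).1 = if s.1 % 2 = 0 then 1 else k := by
    unfold altSign
    refine if_congr ?_ rfl rfl
    rw [even_val_iff h.even_m.two_dvd, zmodParity_altCover_fst h, ZMod.intCast_zmod_eq_zero_iff_dvd]
    omega
  have hv := val_altCover_fst h c g s
  obtain ⟨i, a, b⟩ := s
  match x with
  | 0 =>
    have hpar : (altCover m n k l c g (i, a, b)).2.val ≡ (altCover m n k l c g (i, a, b)).1.val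
        [MOD 2] ↔ (i + a + b) % 2 = 0 := by
      rw [val_modEq_iff h.even_m.two_dvd h.even_n.two_dvd, zmodParity_altCover_fst h,
        zmodParity_altCover_snd h, ZMod.intCast_eq_intCast_iff, Int.ModEq]
      dsimp only
      omega
    simp only [stateMove, altMove, hpar]
    have hdiv := Int.mul_ediv_add_emod (2 * c + i) m
    have hlt := Int.emod_lt_of_pos (2 * c + i) (by omega : (0 : ℤ) < m)
    have hnn := Int.emod_nonneg (2 * c + i) (by omega : (m : ℤ) ≠ 0)
    simp only at hv
    split_ifs with h1 h2 h3
    · have e : (2 * c + (i + 1)) / (m : ℤ) = (2 * c + i) / m + 1 := by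
        rw [Int.ediv_eq_iff_of_pos (by omega)]
        constructor <;> nlinarith
      refine Prod.ext ?_ ?_ <;> simp only [altCover, e] <;> push_cast <;> ring
    · have e : (2 * c + (i + 1)) / (m : ℤ) = (2 * c + i) / m := by
        rw [Int.ediv_eq_iff_of_pos (by omega)]
        have : (2 * c + i) % m + 1 < m := by omega
        constructor <;> nlinarith
      refine Prod.ext ?_ ?_ <;> simp only [altCover, e] <;> push_cast <;> ring
    · have e : (2 * c + (i - 1)) / (m : ℤ) = (2 * c + i) / m - 1 := by
        rw [Int.ediv_eq_iff_of_pos (by omega)]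
        constructor <;> nlinarith
      refine Prod.ext ?_ ?_ <;> simp only [altCover, e] <;> push_cast <;> ring
    · have e : (2 * c + (i - 1)) / (m : ℤ) = (2 * c + i) / m := by
        rw [Int.ediv_eq_iff_of_pos (by omega)]
        have : 0 < (2 * c + i) % m := by omega
        constructor <;> nlinarith
      refine Prod.ext ?_ ?_ <;> simp only [altCover, e] <;> push_cast <;> ring
  | 1 =>
    simp only [stateMove, altMove, hsign]
    split_ifs with h1 <;> simp only [altCover, Prod.mk.injEq, true_and] <;> push_cast <;> ring
  | 2 =>
    simp only [stateMove, altMove, hsign]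
    split_ifs with h1 <;> simp only [altCover, Prod.mk.injEq, true_and] <;> push_cast <;> ring

/-- The even offsets absorb everything but the two parities, so four base states serve all vertices.
-/
theorem exists_altCover_eq (h : AltParams m n k l) (v : ZMod m × ZMod n) :
    ∃ c g : ℤ, ∃ p q : Fin 2, altCover m n k l c g (p.val, q.val, 0) = v := by
  have := h.neZero_m
  have := h.neZero_n
  have h1 := ZMod.val_lt v.1
  refine ⟨(v.1.val / 2 : ℕ), (v.2.val / 2 : ℕ), ⟨v.1.val % 2, Nat.mod_lt _ two_pos⟩,
    ⟨v.2.val % 2, Nat.mod_lt _ two_pos⟩, ?_⟩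
  have e1 : (2 * ((v.1.val / 2 : ℕ) : ℤ) + ((v.1.val % 2 : ℕ) : ℤ)) = (v.1.val : ℕ) := by omega
  have e2 : (2 * ((v.2.val / 2 : ℕ) : ℤ) + ((v.2.val % 2 : ℕ) : ℤ)) = (v.2.val : ℕ) := by omega
  have e3 : ((v.1.val : ℕ) : ℤ) / m = 0 := Int.ediv_eq_zero_of_lt (by omega) (by omega)
  simp only [altCover, e1, e2, e3]
  ext <;> simp

theorem stateMove_oppMove (x : Fin 3) (s : ℤ × ℤ × ℤ) :
    stateMove (oppMove x) (stateMove x s) = s := by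
  obtain ⟨i, a, b⟩ := s
  match x with
  | 0 | 1 | 2 =>
    simp only [stateMove, oppMove]
    split_ifs <;> first | (simp; done) | (exfalso; dsimp only at *; omega)

theorem altMove_oppMove (h : AltParams m n k l) (x : Fin 3) (v : ZMod m × ZMod n) :
    altMove m n k l (oppMove x) (altMove m n k l x v) = v := by
  obtain ⟨c, g, p, q, rfl⟩ := exists_altCover_eq h v
  rw [← altCover_stateMove h, ← altCover_stateMove h, stateMove_oppMove]

theorem altMove_zero_fst_ne (h : AltParams m n k l) (v : ZMod m × ZMod n) :
    (altMove m n k l 0 v).1 ≠ v.1 := by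
  have := h.fact_one_lt_m
  simp only [altMove]
  split_ifs <;> simp

theorem altMove_injective (h : AltParams m n k l) (v : ZMod m × ZMod n) :
    Function.Injective fun x => altMove m n k l x v := by
  have h0 : ∀ w, w.1 = v.1 → altMove m n k l 0 v ≠ w := fun w hw e =>
    altMove_zero_fst_ne h v (by rw [e, hw])
  have h12 : altMove m n k l 1 v ≠ altMove m n k l 2 v := by
    intro e
    refine h.two_mul_altSign_ne_zero v.1 ?_
    simp only [altMove, Prod.mk.injEq, true_and] at e
    linear_combination e
  intro x y e
  match x, y with
  | 0, 0 | 1, 1 | 2, 2 => rfl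
  | 0, 1 => exact absurd e (h0 _ rfl)
  | 0, 2 => exact absurd e (h0 _ rfl)
  | 1, 0 => exact absurd e.symm (h0 _ rfl)
  | 2, 0 => exact absurd e.symm (h0 _ rfl)
  | 1, 2 => exact absurd e h12
  | 2, 1 => exact absurd e.symm h12

theorem altMove_ne (h : AltParams m n k l) (x : Fin 3) (v : ZMod m × ZMod n) :
    altMove m n k l x v ≠ v := by
  have hs : altSign m n k v.1 ≠ 0 := fun e => h.two_mul_altSign_ne_zero v.1 (by rw [e, mul_zero])
  intro e
  match x with
  | 0 => exact altMove_zero_fst_ne h v (by rw [e])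
  | 1 => exact hs (by simpa [altMove, Prod.ext_iff] using e)
  | 2 => exact hs (by simpa [altMove, Prod.ext_iff] using e)

/-- The relation of which `altX` is the symmetric closure. -/
def altRel (m n : ℕ) (k l : ZMod n) (u v : ZMod m × ZMod n) : Prop :=
  (u.1.val + 1 < m ∧ u.2.val ≡ u.1.val [MOD 2] ∧ v = (u.1 + 1, u.2)) ∨
    (u.1.val + 1 = m ∧ u.2.val ≡ u.1.val [MOD 2] ∧ v = (0, u.2 + l)) ∨
    (u.2.val ≡ u.1.val [MOD 2] ∧
      (v = (u.1, u.2 + altSign m n k u.1) ∨ v = (u.1, u.2 + -altSign m n k u.1)))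

theorem altRel_iff (h : AltParams m n k l) (u v : ZMod m × ZMod n) :
    altRel m n k l u v ↔ u.2.val ≡ u.1.val [MOD 2] ∧ ∃ x, v = altMove m n k l x u := by
  have := h.neZero_m
  have hlt := ZMod.val_lt u.1
  have hwrap : u.1.val + 1 = m → u.1 + 1 = 0 := by
    intro e
    have : ((u.1.val + 1 : ℕ) : ZMod m) = 0 := by rw [e]; exact ZMod.natCast_self m
    simpa using this
  by_cases hp : u.2.val ≡ u.1.val [MOD 2]
  · simp only [altRel, hp, true_and, Fin.exists_fin_succ, altMove, if_true, sub_eq_add_neg]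
    by_cases hw : u.1.val + 1 = m
    · simp [hw, hwrap hw]
    · simp [hw, (by omega : u.1.val + 1 < m)]
  · simp [altRel, hp]

/-- The graph is bipartite with classes given by the parity of `i + j`. As `altRel` lists each edge
from one class only, its symmetric closure gives all moves at every vertex. -/
theorem parity_altMove (h : AltParams m n k l) (x : Fin 3) (v : ZMod m × ZMod n) :
    (altMove m n k l x v).2.val ≡ (altMove m n k l x v).1.val [MOD 2] ↔
      ¬ v.2.val ≡ v.1.val [MOD 2] := by
  have := h.neZero_m
  have := h.neZero_n
  obtain ⟨c, g, p, q, rfl⟩ := exists_altCover_eq h v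
  rw [← altCover_stateMove h]
  simp only [val_modEq_iff h.even_m.two_dvd h.even_n.two_dvd, zmodParity_altCover_fst h,
    zmodParity_altCover_snd h, ZMod.intCast_eq_intCast_iff, Int.ModEq]
  match x with
  | 0 | 1 | 2 =>
    simp only [stateMove]
    split_ifs <;> simp only <;> omega

theorem cubicMoves_altX (h : AltParams m n k l) : CubicMoves (altX m n k l) (altMove m n k l) where
  opp := altMove_oppMove h
  inj := altMove_injective h
  adj_iff v w := by
    have hadj : (altX m n k l).Adj v w ↔ v ≠ w ∧ (altRel m n k l v w ∨ altRel m n k l w v) :=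
      SimpleGraph.fromRel_adj _ _ _
    rw [hadj, altRel_iff h, altRel_iff h]
    constructor
    · rintro ⟨-, ⟨-, hx⟩ | ⟨-, x, rfl⟩⟩
      · exact hx
      · exact ⟨oppMove x, (altMove_oppMove h x w).symm⟩
    · rintro ⟨x, rfl⟩
      refine ⟨(altMove_ne h x v).symm, ?_⟩
      by_cases hp : v.2.val ≡ v.1.val [MOD 2]
      · exact Or.inl ⟨hp, x, rfl⟩
      · exact Or.inr ⟨(parity_altMove h x v).2 hp, oppMove x, (altMove_oppMove h x v).symm⟩

end

/-! ### From walk counts to invariance of the levels -/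

section

variable {m n : ℕ} {k l : ZMod n}

theorem altCover_eq_iff (h : AltParams m n k l) (c g : ℤ) (s d : ℤ × ℤ × ℤ) :
    altCover m n k l c g (s.1 + d.1, s.2.1 + d.2.1, s.2.2 + d.2.2) = altCover m n k l c g s ↔
      ∃ w : ℤ, d.1 = m * w ∧ (d.2.1 : ZMod n) + d.2.2 * k + w * l = 0 := by
  have hm : (m : ℤ) ≠ 0 := by have := h.four_le_m; omega
  have hfst : (((2 * c + (s.1 + d.1) : ℤ) : ZMod m) = ((2 * c + s.1 : ℤ) : ZMod m)) ↔
      ∃ w : ℤ, d.1 = m * w := by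
    rw [eq_comm, ZMod.intCast_eq_intCast_iff, Int.modEq_iff_dvd,
      show 2 * c + (s.1 + d.1) - (2 * c + s.1) = d.1 by ring]
    rfl
  simp only [altCover, Prod.mk.injEq, hfst, ← exists_and_right]
  refine exists_congr fun w => and_congr_right fun hw => ?_
  rw [show 2 * c + (s.1 + d.1) = 2 * c + s.1 + m * w by rw [hw]; ring,
    Int.add_mul_ediv_left _ _ hm, ← sub_eq_zero]
  push_cast
  refine Eq.congr_left ?_
  ring

/-- The predicate `P` singles out the closed words. -/
def DetectsClosed (m n : ℕ) (k l : ZMod n) (P : ℤ × ℤ × ℤ → Bool) : Prop :=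
  ∀ d, shiftBound d →
    ((∃ w : ℤ, d.1 = m * w ∧ (d.2.1 : ZMod n) + d.2.2 * k + w * l = 0) ↔ P d = true)

/-- The total length is 10: the move `x` followed by nine steps. -/
theorem walkCount_altX (h : AltParams m n k l) [Fintype (ZMod m × ZMod n)]
    {P : ℤ × ℤ × ℤ → Bool} (hP : DetectsClosed m n k l P) (c g : ℤ) (p q : Fin 2) (x : Fin 3)
    {v : ZMod m × ZMod n} (hv : altCover m n k l c g (p.val, q.val, 0) = v) :
    walkCount (altX m n k l) v (altMove m n k l x v) 9 v (altMove m n k l x v) =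
      (wordShifts p q x).countP P := by
  rw [walkCount_eq_countP (cubicMoves_altX h) (altCover m n k l c g) (altCover_stateMove h c g)
    v x 9 x v (stateMove x (p.val, q.val, 0)) (by rw [altCover_stateMove h, hv])]
  have hb := shiftBound_of_mem_wordShifts p q x
  rw [wordShifts, List.countP_map]
  refine List.countP_congr fun s hs => ?_
  rw [Function.comp_apply, ← hP _ (hb _ (List.mem_map_of_mem hs)),
    ← altCover_eq_iff h c g (p.val, q.val, 0), hv]
  simp

theorem iso_apply_fst_eq (h : AltParams m n k l) {P : ℤ × ℤ × ℤ → Bool}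
    (hP : DetectsClosed m n k l P) (hsep : Separates P) (φ : altX m n k l ≃g altX m n k l)
    (i : ZMod m) (j : ZMod n) : (φ (i, j + altSign m n k i)).1 = (φ (i, j)).1 := by
  have := h.neZero_m
  have := h.neZero_n
  obtain ⟨A, -, hA⟩ := hsep
  set v : ZMod m × ZMod n := (i, j)
  have hadj : (altX m n k l).Adj (φ v) (φ (altMove m n k l 1 v)) := by
    rw [φ.map_adj_iff, (cubicMoves_altX h).adj_iff]
    exact ⟨1, rfl⟩
  obtain ⟨y, hy⟩ := ((cubicMoves_altX h).adj_iff _ _).1 hadj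
  obtain ⟨c, g, p, q, hv⟩ := exists_altCover_eq h v
  obtain ⟨c', g', p', q', hv'⟩ := exists_altCover_eq h (φ v)
  have e := walkCount_iso φ v (altMove m n k l 1 v) 9 v (altMove m n k l 1 v)
  rw [hy, walkCount_altX h hP c g p q 1 hv, walkCount_altX h hP c' g' p' q' y hv'] at e
  have hy' : φ (i, j + altSign m n k i) = altMove m n k l y (φ v) := hy
  rw [hy']
  have hy0 : y ≠ 0 := by
    rintro rfl
    exact (hA p q).2.1 (e.symm.trans (hA p' q').1)
  clear e hy hy'
  match y, hy0 with
  | 1, _ | 2, _ => rfl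

/-- Oddness makes `k` coprime to 2, and `2k² = ±2` gives `k² ≡ ±1` modulo `n / 2`. Hence the
multiples of `k_i` exhaust `ℤ_n`, and each level is connected by its own edges. -/
theorem isUnit_altSign (h : AltParams m n k l) (i : ZMod m) : IsUnit (altSign m n k i) := by
  unfold altSign
  split_ifs
  · exact isUnit_one
  · have := h.neZero_n
    obtain ⟨r, hr⟩ := h.even_n
    obtain ⟨x, rfl⟩ : ∃ x : ℤ, (x : ZMod n) = k := ⟨k.val, by simp⟩
    have hodd : IsCoprime x 2 := by
      have hpar := zmodParity_of_odd (even_iff_two_dvd.1 h.even_n) h.odd_k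
      rw [map_intCast, ← Int.cast_one, ZMod.intCast_eq_intCast_iff] at hpar
      exact ⟨1, -(x / 2), by unfold Int.ModEq at hpar; push_cast at hpar; omega⟩
    have hr' : IsCoprime x r := by
      rcases h.two_mul_sq with e | e
      · have : ((2 * x ^ 2 - 2 : ℤ) : ZMod n) = 0 := by
          push_cast
          rw [e, sub_self]
        rw [ZMod.intCast_zmod_eq_zero_iff_dvd, hr] at this
        obtain ⟨t, ht⟩ := this
        exact ⟨x, -t, by push_cast at ht; linarith⟩
      · have : ((2 * x ^ 2 + 2 : ℤ) : ZMod n) = 0 := by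
          push_cast
          rw [e, neg_add_cancel]
        rw [ZMod.intCast_zmod_eq_zero_iff_dvd, hr] at this
        obtain ⟨t, ht⟩ := this
        exact ⟨-x, t, by push_cast at ht; linarith⟩
    have hco : IsCoprime x n := by
      have := hodd.mul_right hr'
      rwa [show (2 : ℤ) * r = n by rw [hr]; push_cast; ring] at this
    obtain ⟨a, b, hab⟩ := hco
    refine IsUnit.of_mul_eq_one (a : ZMod n) ?_
    have := congrArg (Int.cast : ℤ → ZMod n) hab
    push_cast at this
    rwa [ZMod.natCast_self, mul_zero, add_zero, mul_comm] at this

theorem iso_apply_fst_const (h : AltParams m n k l) {P : ℤ × ℤ × ℤ → Bool}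
    (hP : DetectsClosed m n k l P) (hsep : Separates P) (φ : altX m n k l ≃g altX m n k l)
    (i : ZMod m) (j : ZMod n) : (φ (i, j)).1 = (φ (i, 0)).1 := by
  have := h.neZero_n
  have hstep : ∀ t : ℕ, (φ (i, t * altSign m n k i)).1 = (φ (i, 0)).1 := by
    intro t
    induction t with
    | zero => simp
    | succ t ih => rw [← ih, Nat.cast_succ, add_one_mul, iso_apply_fst_eq h hP hsep]
  obtain ⟨u, hu⟩ := (isUnit_altSign h i).exists_left_inv
  have := hstep (j * u).val
  rwa [ZMod.natCast_val, ZMod.cast_id, mul_assoc, hu, mul_one] at this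

theorem preservedByAut_of_separates (h : AltParams m n k l) {P : ℤ × ℤ × ℤ → Bool}
    (hP : DetectsClosed m n k l P) (hsep : Separates P) :
    PreservedByAut (altX m n k l) (altTwoFactor m n k l) := by
  have hsub : ∀ (φ : altX m n k l ≃g altX m n k l) (i : ZMod m),
      (altCycle m n k l i).map φ.toHom = altCycle m n k l (φ (i, 0)).1 := by
    intro φ i
    have hverts : ∀ v, (φ.symm v).1 = i ↔ v.1 = (φ (i, 0)).1 := by
      intro v
      constructor
      · intro hv
        have := iso_apply_fst_const h hP hsep φ i (φ.symm v).2
        rwa [← hv, Prod.mk.eta, φ.apply_symm_apply, hv] at this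
      · intro hv
        have h1 := iso_apply_fst_const h hP hsep φ.symm v.1 v.2
        have h2 := iso_apply_fst_const h hP hsep φ.symm v.1 (φ (i, 0)).2
        rw [hv, Prod.mk.eta, φ.symm_apply_apply] at h2
        rw [Prod.mk.eta, hv, ← h2] at h1
        exact h1
    ext u v
    · simp only [altCycle, SimpleGraph.Subgraph.map_verts, SimpleGraph.Subgraph.induce_verts,
        Set.mem_image, Set.mem_ofPred_eq]
      rw [← hverts]
      constructor
      · rintro ⟨w, hw, rfl⟩
        exact (congrArg Prod.fst (φ.symm_apply_apply w)).trans hw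
      · exact fun hu => ⟨φ.symm u, hu, φ.apply_symm_apply u⟩
    · simp only [altCycle, SimpleGraph.Subgraph.map_adj, SimpleGraph.Subgraph.induce_adj,
        Set.mem_ofPred_eq, SimpleGraph.Subgraph.top_adj, Relation.map_apply]
      rw [← hverts, ← hverts]
      constructor
      · rintro ⟨a, b, ⟨ha, hb, hab⟩, rfl, rfl⟩
        exact ⟨(congrArg Prod.fst (φ.symm_apply_apply a)).trans ha,
          (congrArg Prod.fst (φ.symm_apply_apply b)).trans hb, φ.map_adj_iff.2 hab⟩
      · rintro ⟨ha, hb, hab⟩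
        exact ⟨φ.symm u, φ.symm v, ⟨ha, hb, φ.symm.map_adj_iff.2 hab⟩, φ.apply_symm_apply u,
          φ.apply_symm_apply v⟩
  intro φ
  ext C
  constructor
  · rintro ⟨_, ⟨i, rfl⟩, rfl⟩
    exact ⟨_, (hsub φ i).symm⟩
  · rintro ⟨i, rfl⟩
    -- The level that `φ` sends to level `i` is that of the preimage of `(i, 0)`.
    refine ⟨_, ⟨(φ.symm (i, 0)).1, rfl⟩, ?_⟩
    have := iso_apply_fst_const h hP hsep φ (φ.symm (i, 0)).1 (φ.symm (i, 0)).2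
    rw [Prod.mk.eta, φ.apply_symm_apply] at this
    exact (hsub φ _).trans (by rw [← this])

end

/-! ### Short relations in `ℤ_n` -/

section

variable {m n : ℕ} {k l : ZMod n}

theorem AltParams.exists_sign (h : AltParams m n k l) :
    ∃ e : ℤ, (e = 1 ∨ e = -1) ∧ 2 * k ^ 2 = ((2 * e : ℤ) : ZMod n) := by
  rcases h.two_mul_sq with h2 | h2
  · exact ⟨1, Or.inl rfl, by rw [h2]; norm_num⟩
  · exact ⟨-1, Or.inr rfl, by rw [h2]; norm_num⟩

/-- Modulo 16, `4k` depends only on `k` modulo 4, and `k` is odd. -/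
theorem AltParams.ne_sixteen (h : AltParams m n k l) (h4 : ¬(4 * k = 4 ∨ 4 * k = -4)) :
    n ≠ 16 := by
  rintro rfl
  obtain ⟨y, rfl⟩ := h.odd_k
  have : ∀ y : ZMod 16, 4 * (2 * y + 1) = 4 ∨ 4 * (2 * y + 1) = -4 := by decide
  exact h4 (this y)

/-- The position `2 a + 2 b k` of `ℤ_n` is zero. -/
def EvenRelation (k : ZMod n) (a b : ℤ) : Prop :=
  ((2 * a : ℤ) : ZMod n) + ((2 * b : ℤ) : ZMod n) * k = 0

theorem EvenRelation.sub {a b c d : ℤ} (h₁ : EvenRelation k a b) (h₂ : EvenRelation k c d) :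
    EvenRelation k (a - c) (b - d) := by
  unfold EvenRelation at *
  push_cast at *
  linear_combination h₁ - h₂

theorem EvenRelation.swap {e : ℤ} (he : 2 * k ^ 2 = ((2 * e : ℤ) : ZMod n)) {a b : ℤ}
    (h : EvenRelation k a b) : EvenRelation k (e * b) a := by
  unfold EvenRelation at *
  push_cast at *
  linear_combination k * h - b * he

theorem EvenRelation.eq_zero_of_right {a : ℤ} (h : EvenRelation k a 0) (hn : 14 ≤ n)
    (ha : a.natAbs ≤ 5) : a = 0 := by
  simp only [EvenRelation, mul_zero, Int.cast_zero, zero_mul, add_zero] at h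
  rw [ZMod.intCast_zmod_eq_zero_iff_dvd] at h
  by_contra h0
  have := Int.natAbs_le_of_dvd_ne_zero h (by omega)
  omega

theorem EvenRelation.eq_zero_of_left (hp : AltParams m n k l) {b : ℤ} (h : EvenRelation k 0 b)
    (hn : 14 ≤ n) (hb : b.natAbs ≤ 5) : b = 0 := by
  obtain ⟨e, he, hk⟩ := hp.exists_sign
  have := (h.swap hk).eq_zero_of_right hn (by rcases he with rfl | rfl <;> omega)
  rcases he with rfl | rfl <;> omega

/-- Multiply by the conjugate `a - bk` and use `2k² = 2e`. -/
theorem EvenRelation.dvd {e : ℤ} (he : 2 * k ^ 2 = ((2 * e : ℤ) : ZMod n)) {a b : ℤ}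
    (h : EvenRelation k a b) : (n : ℤ) ∣ 2 * (a * a - e * (b * b)) := by
  unfold EvenRelation at h
  rw [← ZMod.intCast_zmod_eq_zero_iff_dvd]
  push_cast at *
  linear_combination (a - b * k) * h + b ^ 2 * he

/-- For `a = ±b` the relation yields `4k = ±4`. Otherwise, with `a` and `b` nonzero, `n` divides the
norm `2(a² - eb²)`, one of `±6`, `10`, `±16`, `20`; with `n ≥ 14` only 16 and 20 could remain. -/
theorem EvenRelation.eq_zero (hp : AltParams m n k l) (hn : 14 ≤ n)
    (h4 : ¬(4 * k = 4 ∨ 4 * k = -4)) (hn20 : n ≠ 20) {a b : ℤ} (h : EvenRelation k a b)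
    (hab : a.natAbs + b.natAbs ≤ 4) : a = 0 ∧ b = 0 := by
  have hn16 := hp.ne_sixteen h4
  by_cases hb : b = 0
  · subst hb
    exact ⟨h.eq_zero_of_right hn (by omega), rfl⟩
  by_cases ha : a = 0
  · subst ha
    exact ⟨rfl, h.eq_zero_of_left hp hn (by omega)⟩
  exfalso
  by_cases hsame : a = b ∨ a = -b
  · have h4' : EvenRelation k 2 2 ∨ EvenRelation k 2 (-2) := by
      have hb' : b = 1 ∨ b = -1 ∨ b = 2 ∨ b = -2 := by omega
      unfold EvenRelation at *
      rcases hsame with rfl | rfl <;> rcases hb' with rfl | rfl | rfl | rfl <;> push_cast at *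
      · left; linear_combination 2 * h
      · left; linear_combination -2 * h
      · left; linear_combination h
      · left; linear_combination -h
      · right; linear_combination -2 * h
      · right; linear_combination 2 * h
      · right; linear_combination -h
      · right; linear_combination h
    unfold EvenRelation at h4'
    push_cast at h4'
    rcases h4' with e | e
    · exact h4 (Or.inr (by linear_combination e))
    · exact h4 (Or.inl (by linear_combination -e))
  · obtain ⟨e, he, hk⟩ := hp.exists_sign
    have hdvd := h.dvd hk
    have hval : ∃ c : ℤ, (c = 6 ∨ c = -6 ∨ c = 10 ∨ c = 16 ∨ c = -16 ∨ c = 20) ∧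
        2 * (a * a - e * (b * b)) = c := by
      refine ⟨_, ?_, rfl⟩
      have ha' : a = 1 ∨ a = -1 ∨ a = 2 ∨ a = -2 ∨ a = 3 ∨ a = -3 := by omega
      have hb' : b = 1 ∨ b = -1 ∨ b = 2 ∨ b = -2 ∨ b = 3 ∨ b = -3 := by omega
      rcases he with rfl | rfl <;> rcases ha' with rfl | rfl | rfl | rfl | rfl | rfl <;>
        rcases hb' with rfl | rfl | rfl | rfl | rfl | rfl <;> omega
    obtain ⟨c, hc, hc'⟩ := hval
    rw [hc'] at hdvd
    have hle := Int.natAbs_le_of_dvd_ne_zero hdvd (by omega)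
    obtain ⟨t, ht⟩ := hdvd
    have hlt : n ≤ 20 := by omega
    clear hc' hk h h4 hp
    interval_cases n <;> omega

/-- The closed words are those of displacement zero, up to the relations `R` on the words that
traverse all four levels. -/
theorem detectsClosed_closedShift (hp : AltParams m n k l) (hn : 14 ≤ n)
    (h4 : ¬(4 * k = 4 ∨ 4 * k = -4)) (hn20 : n ≠ 20) (R : List (ℤ × ℤ))
    (hR : ∀ a b : ℤ, a.natAbs + b.natAbs ≤ 3 → a.natAbs ≤ 2 → b.natAbs ≤ 2 →
      ((m = 4 ∧ ((2 * a : ℤ) : ZMod n) + ((2 * b : ℤ) : ZMod n) * k + l = 0) ↔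
        (2 * a, 2 * b) ∈ R))
    (hm : R = [] ∨ m = 4) :
    DetectsClosed m n k l (closedShift R) := by
  have hm4 := hp.four_le_m
  rintro ⟨i, a, b⟩ ⟨⟨hi, hi'⟩, h0, h1⟩
  simp only at hi hi' h0 h1 ⊢
  have hme := hp.even_m
  simp only [closedShift, decide_eq_true_eq, Prod.mk.injEq]
  constructor
  · rintro ⟨w, hw, e⟩
    -- A level displacement of at most 5 is a nonzero multiple of the even number `m ≥ 4` only if it
    -- is `±4`.
    have hw' : w = 0 ∨ (m = 4 ∧ (w = 1 ∨ w = -1)) := by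
      by_cases hw0 : w = 0
      · exact Or.inl hw0
      · right
        have : m < 6 := by
          have := Int.natAbs_mul m w
          have : 1 ≤ w.natAbs := by omega
          have : i.natAbs ≤ 5 := by omega
          have : (m : ℤ).natAbs * 1 ≤ (m : ℤ).natAbs * w.natAbs := by gcongr
          rw [hw] at *
          omega
        obtain ⟨r, hr⟩ := hme
        have : m = 4 := by omega
        subst this
        refine ⟨rfl, ?_⟩
        push_cast at hw
        omega
    rcases hw' with rfl | ⟨rfl, rfl | rfl⟩
    · left
      rw [mul_zero] at hw
      obtain ⟨⟨a, rfl⟩, ⟨b, rfl⟩, hb⟩ := h0 hw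
      have hz : EvenRelation k a b := by
        unfold EvenRelation
        simpa using e
      rcases hb with hb | ⟨hb, hb0⟩ | ⟨hb0, hb⟩
      · have := hz.eq_zero hp hn h4 hn20 (by omega)
        omega
      · obtain rfl : b = 0 := by omega
        have := hz.eq_zero_of_right hn (by omega)
        omega
      · obtain rfl : a = 0 := by omega
        have := hz.eq_zero_of_left hp hn (by omega)
        omega
    · right; left
      push_cast at hw
      obtain ⟨⟨a, rfl⟩, ⟨b, rfl⟩, hb⟩ := h1 (by omega)
      exact ⟨by omega, (hR a b (by omega) (by omega) (by omega)).1 ⟨rfl, by simpa using e⟩⟩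
    · right; right
      push_cast at hw
      obtain ⟨⟨a, rfl⟩, ⟨b, rfl⟩, hb⟩ := h1 (by omega)
      have := (hR (-a) (-b) (by omega) (by omega) (by omega)).1 ⟨rfl, by push_cast at e ⊢; linear_combination -e⟩
      refine ⟨by omega, ?_⟩
      rwa [Prod.neg_mk, ← mul_neg, ← mul_neg]
  · rintro (⟨rfl, rfl, rfl⟩ | ⟨rfl, hmem⟩ | ⟨rfl, hmem⟩)
    · exact ⟨0, by simp, by simp⟩
    · rcases hm with rfl | rfl
      · simp at hmem
      · obtain ⟨⟨a, rfl⟩, ⟨b, rfl⟩, hb⟩ := h1 (by omega)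
        exact ⟨1, by simp, by simpa using ((hR a b (by omega) (by omega) (by omega)).2 hmem).2⟩
    · rcases hm with rfl | rfl
      · simp at hmem
      · obtain ⟨⟨a, rfl⟩, ⟨b, rfl⟩, hb⟩ := h1 (by omega)
        rw [Prod.neg_mk, ← mul_neg, ← mul_neg] at hmem
        have := ((hR (-a) (-b) (by omega) (by omega) (by omega)).2 hmem).2
        refine ⟨-1, by simp, ?_⟩
        push_cast at this ⊢
        linear_combination -this

/-- Words of level displacement at most 5 cannot wind around, so `l` plays no role. -/
theorem detectsClosed_of_six_le (hm : 6 ≤ m) {c : ℤ} (hk : k = c) :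
    DetectsClosed m n k l (fun s => s.1 = 0 ∧ (s.2.1 + s.2.2 * c) % n = 0) := by
  rintro ⟨i, a, b⟩ ⟨⟨hi, hi'⟩, -⟩
  simp only at hi hi' ⊢
  rw [decide_eq_true_eq, ← Int.dvd_iff_emod_eq_zero, ← ZMod.intCast_zmod_eq_zero_iff_dvd]
  constructor
  · rintro ⟨w, hw, e⟩
    have h0 : i = 0 := by
      refine Int.eq_zero_of_abs_lt_dvd (⟨w, hw⟩ : (m : ℤ) ∣ i) ?_
      rw [abs_lt]; omega
    refine ⟨h0, ?_⟩
    have hw0 : w = 0 := by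
      rw [h0] at hw
      rcases mul_eq_zero.1 hw.symm with h1 | h1
      · omega
      · exact h1
    rw [hw0, hk] at e
    push_cast
    simpa using e
  · rintro ⟨h0, e⟩
    refine ⟨0, by simp [h0], ?_⟩
    rw [hk]
    push_cast at e
    simpa using e

theorem detectsClosed_four_zero {n : ℕ} {k : ZMod n} {c : ℤ} (hk : k = c) :
    DetectsClosed 4 n k 0
      (fun s => (s.1 = 0 ∨ s.1 = 4 ∨ s.1 = -4) ∧ (s.2.1 + s.2.2 * c) % n = 0) := by
  rintro ⟨i, a, b⟩ ⟨⟨hi, hi'⟩, -⟩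
  simp only at hi hi' ⊢
  rw [decide_eq_true_eq, ← Int.dvd_iff_emod_eq_zero, ← ZMod.intCast_zmod_eq_zero_iff_dvd, hk]
  push_cast
  simp only [mul_zero, add_zero, exists_and_right]
  refine and_congr_left fun _ => ⟨?_, ?_⟩
  · rintro ⟨w, hw⟩
    omega
  · rintro (rfl | rfl | rfl)
    exacts [⟨0, by norm_num⟩, ⟨1, by norm_num⟩, ⟨-1, by norm_num⟩]

end

/-! ### Winding relations for `m = 4` -/

section

variable {n : ℕ} {k l : ZMod n}

/-- The words of displacement `(4, 2 a, 2 b)` are closed in `𝒳ₐ(4, n, k, ℓ)`. -/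
def WindingRelation (k l : ZMod n) (a b : ℤ) : Prop :=
  ((2 * a : ℤ) : ZMod n) + ((2 * b : ℤ) : ZMod n) * k + l = 0

theorem WindingRelation.sub {a b c d : ℤ} (h₁ : WindingRelation k l a b)
    (h₂ : WindingRelation k l c d) : EvenRelation k (a - c) (b - d) := by
  unfold WindingRelation EvenRelation at *
  push_cast at *
  linear_combination h₁ - h₂

/-- Multiplication by `k - σ` eliminates `l`. -/
theorem WindingRelation.evenRelation {e σ : ℤ} (he : 2 * k ^ 2 = ((2 * e : ℤ) : ZMod n))
    (hσ : l * k = σ * l) {a b : ℤ} (h : WindingRelation k l a b) :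
    EvenRelation k (e * b - σ * a) (a - σ * b) := by
  unfold WindingRelation EvenRelation at *
  push_cast at *
  linear_combination (k - σ) * h - hσ - b * he

theorem WindingRelation.swap {σ : ℤ} (he : 2 * k ^ 2 = ((2 * 1 : ℤ) : ZMod n))
    (hσ : l * k = σ * l) (hσ' : σ = 1 ∨ σ = -1) {a b : ℤ} (h : WindingRelation k l a b) :
    WindingRelation k l (σ * b) (σ * a) := by
  unfold WindingRelation at *
  have hs : (σ : ZMod n) * σ = 1 := by rcases hσ' with rfl | rfl <;> simp
  push_cast at *
  linear_combination σ * k * h - σ * hσ - l * hs - σ * b * he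

theorem mem_of_natAbs_le_two {a : ℤ} (ha : a.natAbs ≤ 2) : a ∈ [(-2 : ℤ), -1, 0, 1, 2] := by
  simp only [List.mem_cons, List.not_mem_nil, or_false]
  omega

/-- The even relation obtained by eliminating `l` must vanish or have size above 4. Vanishing leaves
`(0, 0)` and pairs `(±1, ±1)`. Size above 4 forces `e = 1` and, up to `WindingRelation.swap`, a pair
`(2s, t)`. -/
theorem WindingRelation.cases (hp : AltParams 4 n k l) (hn : 14 ≤ n)
    (h4 : ¬(4 * k = 4 ∨ 4 * k = -4)) (hn20 : n ≠ 20) {e σ : ℤ} (he : e = 1 ∨ e = -1)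
    (hk : 2 * k ^ 2 = ((2 * e : ℤ) : ZMod n)) (hσ' : σ = 1 ∨ σ = -1) (hσ : l * k = σ * l)
    {a b : ℤ} (h : WindingRelation k l a b) (hab : a.natAbs + b.natAbs ≤ 3) (ha : a.natAbs ≤ 2)
    (hb : b.natAbs ≤ 2) :
    (a = 0 ∧ b = 0) ∨ ((a = 1 ∨ a = -1) ∧ (b = 1 ∨ b = -1)) ∨
      (e = 1 ∧ ∃ s t : ℤ, (s = 1 ∨ s = -1) ∧ (t = 1 ∨ t = -1) ∧ σ = -(s * t) ∧
        WindingRelation k l (2 * s) t) := by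
  have hz := fun hs => (h.evenRelation hk hσ).eq_zero hp hn h4 hn20 hs
  have hsw : e = 1 → WindingRelation k l (σ * b) (σ * a) := by
    rintro rfl
    exact h.swap hk hσ hσ'
  have main : (a = 0 ∧ b = 0) ∨ ((a = 1 ∨ a = -1) ∧ (b = 1 ∨ b = -1)) ∨
      (e = 1 ∧ ((a = 2 ∧ b = -σ) ∨ (a = -2 ∧ b = σ) ∨ (a = -σ ∧ b = 2) ∨ (a = σ ∧ b = -2))) := by
    have key : ∀ e ∈ [(1 : ℤ), -1], ∀ σ ∈ [(1 : ℤ), -1], ∀ a ∈ [(-2 : ℤ), -1, 0, 1, 2],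
        ∀ b ∈ [(-2 : ℤ), -1, 0, 1, 2], a.natAbs + b.natAbs ≤ 3 →
        ((e * b - σ * a).natAbs + (a - σ * b).natAbs ≤ 4 →
          e * b - σ * a = 0 ∧ a - σ * b = 0) →
        (a = 0 ∧ b = 0) ∨ ((a = 1 ∨ a = -1) ∧ (b = 1 ∨ b = -1)) ∨
        (e = 1 ∧
          ((a = 2 ∧ b = -σ) ∨ (a = -2 ∧ b = σ) ∨ (a = -σ ∧ b = 2) ∨ (a = σ ∧ b = -2))) := by
      decide
    exact key e (by simpa using he) σ (by simpa using hσ') a (mem_of_natAbs_le_two ha) b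
      (mem_of_natAbs_le_two hb) hab hz
  rcases main with h0 | h1 | ⟨h1, ⟨rfl, rfl⟩ | ⟨rfl, rfl⟩ | ⟨ha', rfl⟩ | ⟨ha', rfl⟩⟩
  · exact Or.inl h0
  · exact Or.inr (Or.inl h1)
  · exact Or.inr (Or.inr ⟨h1, 1, -σ, by omega, by omega, by ring, h⟩)
  · exact Or.inr (Or.inr ⟨h1, -1, _, by omega, hσ', by ring, by simpa using h⟩)
  · refine Or.inr (Or.inr ⟨h1, σ, -1, by omega, by omega, by ring, ?_⟩)
    convert hsw h1 using 1
    · ring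
    · rw [ha']
      rcases hσ' with rfl | rfl <;> rfl
  · refine Or.inr (Or.inr ⟨h1, -σ, 1, by omega, by omega, by ring, ?_⟩)
    convert hsw h1 using 1
    · ring
    · rw [ha']
      rcases hσ' with rfl | rfl <;> rfl

/-- The difference from `(2s, t)` is an even relation, and may be shifted by `±(3t, 3s)`. For every
other candidate one of these is nonzero of size at most 4. -/
theorem WindingRelation.eq_or_eq (hp : AltParams 4 n k l) (hn : 14 ≤ n)
    (h4 : ¬(4 * k = 4 ∨ 4 * k = -4)) (hn20 : n ≠ 20) {s t : ℤ} (hs : s = 1 ∨ s = -1)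
    (ht : t = 1 ∨ t = -1) (hst : WindingRelation k l (2 * s) t)
    (h3 : EvenRelation k (3 * t) (3 * s)) {a b : ℤ} (h : WindingRelation k l a b)
    (hab : a.natAbs + b.natAbs ≤ 3) (ha : a.natAbs ≤ 2) (hb : b.natAbs ≤ 2) :
    (a = 2 * s ∧ b = t) ∨ (a = -s ∧ b = -(2 * t)) := by
  have d0 := hst.sub h
  have d1 := fun hs => d0.eq_zero hp hn h4 hn20 hs
  have d2 := fun hs => (d0.sub h3).eq_zero hp hn h4 hn20 hs
  have d3 := fun hs => ((h.sub hst).sub h3).eq_zero hp hn h4 hn20 hs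
  have key : ∀ s ∈ [(1 : ℤ), -1], ∀ t ∈ [(1 : ℤ), -1], ∀ a ∈ [(-2 : ℤ), -1, 0, 1, 2],
      ∀ b ∈ [(-2 : ℤ), -1, 0, 1, 2], a.natAbs + b.natAbs ≤ 3 →
      ((2 * s - a).natAbs + (t - b).natAbs ≤ 4 → 2 * s - a = 0 ∧ t - b = 0) →
      ((2 * s - a - 3 * t).natAbs + (t - b - 3 * s).natAbs ≤ 4 →
        2 * s - a - 3 * t = 0 ∧ t - b - 3 * s = 0) →
      ((a - 2 * s - 3 * t).natAbs + (b - t - 3 * s).natAbs ≤ 4 →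
        a - 2 * s - 3 * t = 0 ∧ b - t - 3 * s = 0) →
      (a = 2 * s ∧ b = t) ∨ (a = -s ∧ b = -(2 * t)) := by
    decide
  exact key s (by simpa using hs) t (by simpa using ht) a (mem_of_natAbs_le_two ha) b
    (mem_of_natAbs_le_two hb) hab d1 d2 d3

theorem exists_separates_four (hp : AltParams 4 n k l) (hn : 14 ≤ n)
    (h4 : ¬(4 * k = 4 ∨ 4 * k = -4)) (hn20 : n ≠ 20) :
    ∃ P, DetectsClosed 4 n k l P ∧ Separates P := by
  obtain ⟨e, he, hk⟩ := hp.exists_sign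
  obtain ⟨σ, hσ', hσ⟩ : ∃ σ : ℤ, (σ = 1 ∨ σ = -1) ∧ l * k = σ * l := by
    rcases hp.cond with ⟨h1 | h1, -⟩ | ⟨-, h2, -⟩
    · exact ⟨1, Or.inl rfl, by simp [h1]⟩
    · exact ⟨-1, Or.inr rfl, by simp [h1]⟩
    · exact absurd h2 (by decide)
  have hdet : ∀ R : List (ℤ × ℤ),
      (∀ a b : ℤ, a.natAbs + b.natAbs ≤ 3 → a.natAbs ≤ 2 → b.natAbs ≤ 2 →
        (WindingRelation k l a b ↔ (2 * a, 2 * b) ∈ R)) →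
      DetectsClosed 4 n k l (closedShift R) := fun R hR =>
    detectsClosed_closedShift hp hn h4 hn20 R
      (fun a b h1 h2 h3 => by rw [← hR a b h1 h2 h3]; simp [WindingRelation]) (Or.inr rfl)
  by_cases htwo : e = 1 ∧ ∃ s t : ℤ, (s = 1 ∨ s = -1) ∧ (t = 1 ∨ t = -1) ∧ σ = -(s * t) ∧
      WindingRelation k l (2 * s) t
  · obtain ⟨rfl, s, t, hs, ht, rfl, hst⟩ := htwo
    have hss : s * s = 1 := by rcases hs with rfl | rfl <;> rfl
    have htt : t * t = 1 := by rcases ht with rfl | rfl <;> rfl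
    have h3 := hst.evenRelation hk hσ
    rw [show 1 * t - -(s * t) * (2 * s) = 3 * t by linear_combination 2 * t * hss,
      show 2 * s - -(s * t) * t = 3 * s by linear_combination s * htt] at h3
    have hconj := hst.swap hk hσ hσ'
    rw [show -(s * t) * t = -s by linear_combination -s * htt,
      show -(s * t) * (2 * s) = -(2 * t) by linear_combination -2 * t * hss] at hconj
    refine ⟨closedShift [(4 * s, 2 * t), (-2 * s, -4 * t)], hdet _ ?_,
      separates_closedShift_four s (by simpa using hs) t (by simpa using ht)⟩
    intro a b h1 h2 h2'
    simp only [List.mem_cons, Prod.mk.injEq, List.not_mem_nil, or_false]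
    constructor
    · intro hab
      have := WindingRelation.eq_or_eq hp hn h4 hn20 hs ht hst h3 hab h1 h2 h2'
      omega
    · rintro (⟨e1, e2⟩ | ⟨e1, e2⟩)
      · obtain rfl : a = 2 * s := by omega
        obtain rfl : b = t := by omega
        exact hst
      · obtain rfl : a = -s := by omega
        obtain rfl : b = -(2 * t) := by omega
        exact hconj
  have hcases : ∀ a b, WindingRelation k l a b → a.natAbs + b.natAbs ≤ 3 → a.natAbs ≤ 2 →
      b.natAbs ≤ 2 → (a = 0 ∧ b = 0) ∨ ((a = 1 ∨ a = -1) ∧ (b = 1 ∨ b = -1)) := by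
    intro a b h h1 h2 h3
    rcases h.cases hp hn h4 hn20 he hk hσ' hσ h1 h2 h3 with h | h | h
    · exact Or.inl h
    · exact Or.inr h
    · exact absurd h htwo
  by_cases hone : ∃ a b : ℤ, ((a = 0 ∧ b = 0) ∨ ((a = 1 ∨ a = -1) ∧ (b = 1 ∨ b = -1))) ∧
      WindingRelation k l a b
  · obtain ⟨a, b, hab, hw⟩ := hone
    have hsep : Separates (closedShift [(2 * a, 2 * b)]) := by
      rcases hab with ⟨rfl, rfl⟩ | ⟨ha, hb⟩
      · exact separates_closedShift_zero
      · refine separates_closedShift_two _ ?_ _ ?_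
        · rcases ha with rfl | rfl <;> simp
        · rcases hb with rfl | rfl <;> simp
    refine ⟨_, hdet _ ?_, hsep⟩
    intro c d h1 h2 h2'
    simp only [List.mem_singleton, Prod.mk.injEq]
    constructor
    · intro hcd
      have hcd' := hcases c d hcd h1 h2 h2'
      -- Two candidates differ by at most 2 in each coordinate, so the bound 4 applies and the
      -- relation is unique.
      have := (hcd.sub hw).eq_zero hp hn h4 hn20 (by omega)
      omega
    · rintro ⟨e1, e2⟩
      obtain rfl : c = a := by omega
      obtain rfl : d = b := by omega
      exact hw
  · refine ⟨closedShift [], hdet _ ?_, separates_closedShift_nil⟩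
    intro c d h1 h2 h2'
    simp only [List.not_mem_nil, iff_false]
    exact fun hcd => hone ⟨c, d, hcases c d hcd h1 h2 h2', hcd⟩

/-! ### The case `n = 20` and the conclusion -/

theorem eq_of_twenty {k : ZMod 20} (hk : Odd k) (h2 : 2 * k ^ 2 = 2 ∨ 2 * k ^ 2 = -2)
    (h4 : ¬(4 * k = 4 ∨ 4 * k = -4)) : k = 3 ∨ k = -3 ∨ k = 7 ∨ k = -7 := by
  have key : ∀ y : ZMod 20, (2 * (2 * y + 1) ^ 2 = 2 ∨ 2 * (2 * y + 1) ^ 2 = -2) →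
      ¬(4 * (2 * y + 1) = 4 ∨ 4 * (2 * y + 1) = -4) →
      2 * y + 1 = 3 ∨ 2 * y + 1 = -3 ∨ 2 * y + 1 = 7 ∨ 2 * y + 1 = -7 := by decide
  obtain ⟨y, rfl⟩ := hk
  exact key y h2 h4

theorem eq_zero_or_eq_ten_of_twenty {k l : ZMod 20} (hk : k = 3 ∨ k = -3 ∨ k = 7 ∨ k = -7)
    (hl : Even l) (hkl : l * k = l ∨ l * k = -l) : l = 0 ∨ l = 10 := by
  have key : ∀ y : ZMod 20, ∀ k ∈ [(3 : ZMod 20), -3, 7, -7],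
      ((y + y) * k = y + y ∨ (y + y) * k = -(y + y)) → y + y = 0 ∨ y + y = 10 := by decide
  obtain ⟨y, rfl⟩ := hl
  exact key y k (by simpa using hk) hkl

end

theorem mainTheorem8 (m n : ℕ) (k l : ZMod n) (h : AltParams m n k l) (hn : 14 ≤ n)
    (hC : ¬ PreservedByAut (altX m n k l) (altTwoFactor m n k l)) :
    (4 * k = 4 ∨ 4 * k = -4) ∨
      (m = 4 ∧ n = 20 ∧ (k = 3 ∨ k = -3 ∨ k = 7 ∨ k = -7) ∧ l = 10) := by
  by_contra! hcon
  obtain ⟨h4, hexc⟩ := hcon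
  have h4 : ¬(4 * k = 4 ∨ 4 * k = -4) := by tauto
  refine hC ?_
  suffices ∃ P, DetectsClosed m n k l P ∧ Separates P by
    obtain ⟨P, hP, hsep⟩ := this
    exact preservedByAut_of_separates h hP hsep
  have hm : m = 4 ∨ 6 ≤ m := by
    obtain ⟨r, hr⟩ := h.even_m
    have := h.four_le_m
    omega
  by_cases hn20 : n = 20
  · subst hn20
    have hk := eq_of_twenty h.odd_k h.two_mul_sq h4
    obtain ⟨c, hc, hkc⟩ : ∃ c ∈ [(3 : ℤ), -3, 7, -7], k = c := by
      rcases hk with rfl | rfl | rfl | rfl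
      exacts [⟨3, by simp, by simp⟩, ⟨-3, by simp, by simp⟩, ⟨7, by simp, by simp⟩,
        ⟨-7, by simp, by simp⟩]
    rcases hm with rfl | hm
    · have hl := eq_zero_or_eq_ten_of_twenty hk h.even_l <| by
        rcases h.cond with ⟨h1, -⟩ | ⟨-, h2, -⟩
        · exact h1
        · exact absurd h2 (by decide)
      rcases hl with rfl | rfl
      · exact ⟨_, detectsClosed_four_zero hkc, separates_twenty_four c hc⟩
      · exact absurd rfl (hexc rfl rfl hk)
    · exact ⟨_, detectsClosed_of_six_le hm hkc, separates_twenty c hc⟩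
  · rcases hm with rfl | hm
    · exact exists_separates_four h hn h4 hn20
    · refine ⟨closedShift [], detectsClosed_closedShift h hn h4 hn20 [] ?_ (Or.inl rfl),
        separates_closedShift_nil⟩
      intro a b _ _ _
      simp only [List.not_mem_nil, iff_false]
      omega
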